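/- Let $0<r<1$ and $m\ge 1$, and let $S_i(x)=rR_ix+t_i$ on $\mathbb R^d$ and $S'_i(x)=rR'_ix+t'_i$ on $\mathbb R^{d'}$ $(1\le i\le m)$ be two iterated function systems (IFSs), where the $R_i,R'_i$ are orthogonal and the number $m$ of maps and the ratio $r$ are common to both. Let $K$ and $K'$ be their self-similar sets, that is, the nonempty compact sets with $K=\bigcup_iS_i(K)$ and $K'=\bigcup_iS'_i(K')$. For a word $\mathbf u=i_1\cdots i_n$ over $\Sigma=\{1,\dots,m\}$ and a set $E$ write $S_{\mathbf u}=S_{i_1}\circ\cdots\circ S_{i_n}$ and $E_{\mathbf u}=S_{\mathbf u}(E)$, and similarly for the second IFS. Assume that both IFSs satisfy condition (H): there is $c>0$ such that for all $n\ge1$ and $\mathbf u,\mathbf v\in\Sigma^n$, $K_{\mathbf u}\cap K_{\mathbf v}=\emptyset$ implies $\operatorname{dist}(K_{\mathbf u},K_{\mathbf v})\ge cr^n$ (for the second IFS: the same with $K'$). Fix a nonempty bounded closed set $J\subset\mathbb R^d$ with $S_i(J)\subset J$ for all $i$. The augmented tree $X$ is the graph with vertex set $\bigcup_{n\ge0}\Sigma^n$,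 root the empty word $o$, vertical edges joining $\mathbf u$ and $\mathbf ui$ $(i\in\Sigma)$, and horizontal edges joining distinct words $\mathbf u,\mathbf v$ of the same length with $J_{\mathbf u}\cap J_{\mathbf v}\ne\emptyset$. Let $Y$ be the augmented tree of the second IFS, defined in the same way by a fixed nonempty bounded closed set $J'\subset\mathbb R^{d'}$ with $S'_i(J')\subset J'$ for all $i$. An augmented tree is called simple if its horizontal connected components $T$ (maximal connected horizontal subgraphs on some level $\Sigma^n$) fall into finitely many classes, where $T\sim T'$ if, with $T\Sigma=\{\mathbf ui:\mathbf u\in T,\ i\in\Sigma\}$, there is a bijection $T\cup T\Sigma\to T'\cup T'\Sigma$ that preserves vertical and horizontal edges in both directions. An IFS satisfies the open set condition (OSC) if there is a nonempty open set $U$ such that $S_i(U)\subset U$ for all $i$ and $S_i(U)\cap S_j(U)=\emptyset$ for $i\ne j$. With the graph distance $d(\cdot,\cdot)$, $|x|=d(o,x)$ and $|x\wedge y|=\frac12(|x|+|y|-d(x,y))$, a graph is hyperbolic if for some $\delta>0$, $|x\wedge y|\ge\min\{|x\wedge z|,|z\wedge y|\}-\delta$ for all vertices $x,y,z$; call $a>0$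 admissible for the graph if $e^{\delta a}-1<\sqrt2-1$ for some such $\delta$. For admissible $a$ let $\rho_a(x,y)=e^{-a|x\wedge y|}$ for $x\neq y$ and $\rho_a(x,x)=0$; this is comparable to the metric $\theta_a(x,y)=\inf\sum_i\rho_a(x_{i-1},x_i)$ (infimum over finite chains from $x$ to $y$). The hyperbolic boundary is the completion of the vertex set under this metric minus the vertex set, with the distance function $\rho_a(\xi,\eta)=\liminf_{x\to\xi,\,y\to\eta}\rho_a(x,y)$, where $x,y$ run through vertices. Write $A\simeq B$ (Lipschitz equivalence) if there are a bijection $\sigma:A\to B$ and $C>0$ with $C^{-1}d_A(x,y)\le d_B(\sigma(x),\sigma(y))\le Cd_A(x,y)$ for all $x,y\in A$. **Proposition.** Suppose that either (i) both IFSs satisfy the OSC, or (ii) both augmented trees $X$ and $Y$ are simple. Then $X$ and $Y$ are hyperbolic, and for every $a>0$ that is admissible for both $X$ and $Y$, $$K\simeq K'\iff(\partial X,\rho_a)\simeq(\partial Y,\rho_a).$$ -/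

import Mathlib

open Filter Topology
open scoped NNReal

/-! ### Lipschitz equivalence -/

/-- Two sets with distance functions `dA`, `dB` are Lipschitz equivalent if there is a bijection
distorting the distances at most by a multiplicative constant. -/
def LipschitzEquivalent {A B : Type*} (dA : A → A → ℝ) (dB : B → B → ℝ) : Prop :=
  ∃ σ : A ≃ B, ∃ C : ℝ, 0 < C ∧
    ∀ x y : A, C⁻¹ * dA x y ≤ dB (σ x) (σ y) ∧ dB (σ x) (σ y) ≤ C * dA x y

/-! ### Hyperbolic graphs and their boundaries -/

namespace RootedGraph

variable {V : Type*}

/-- The Gromov product `|x ∧ y| = (|x| + |y| - d(x, y)) / 2` in the graph `G` with root `o`,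
where `d` is the graph distance and `|x| = d(o, x)`. -/
noncomputable def gromovProduct (G : SimpleGraph V) (o x y : V) : ℝ :=
  ((G.dist o x : ℝ) + (G.dist o y : ℝ) - (G.dist x y : ℝ)) / 2

theorem gromovProduct_comm (G : SimpleGraph V) (o x y : V) :
    gromovProduct G o x y = gromovProduct G o y x := by
  unfold gromovProduct
  rw [SimpleGraph.dist_comm (u := x) (v := y)]
  ring

/-- The hyperbolicity inequality with constant `δ`. -/
def IsHyperbolicWith (G : SimpleGraph V) (o : V) (δ : ℝ) : Prop :=
  ∀ x y z : V,
    min (gromovProduct G o x z) (gromovProduct G o z y) - δ ≤ gromovProduct G o x y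

/-- `G` is hyperbolic with respect to the root `o`. -/
def IsHyperbolic (G : SimpleGraph V) (o : V) : Prop :=
  ∃ δ : ℝ, 0 < δ ∧ IsHyperbolicWith G o δ

/-- The parameters `a > 0` for which the hyperbolic metric is defined:
`exp (δ a) - 1 < √2 - 1` for a hyperbolicity constant `δ > 0` of the graph. -/
def IsAdmissible (G : SimpleGraph V) (o : V) (a : ℝ) : Prop :=
  0 < a ∧ ∃ δ : ℝ, 0 < δ ∧ IsHyperbolicWith G o δ ∧ Real.exp (δ * a) - 1 < Real.sqrt 2 - 1

open Classical in
/-- `ρ_a(x, y) = exp (-a |x ∧ y|)` if `x ≠ y`, and `0` otherwise. -/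
noncomputable def rho (G : SimpleGraph V) (o : V) (a : ℝ) (x y : V) : ℝ≥0 :=
  if x = y then 0 else ⟨Real.exp (-a * gromovProduct G o x y), (Real.exp_pos _).le⟩

theorem rho_self (G : SimpleGraph V) (o : V) (a : ℝ) (x : V) : rho G o a x x = 0 := by
  simp [rho]

theorem rho_comm (G : SimpleGraph V) (o : V) (a : ℝ) (x y : V) :
    rho G o a x y = rho G o a y x := by
  by_cases h : x = y
  · rw [h]
  · simp only [rho, gromovProduct_comm G o x y, h, Ne.symm h]

/-- The vertex set of `G`, to be equipped with the hyperbolic metric of parameter `a`. -/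
def MetricVertex (_G : SimpleGraph V) (_o : V) (_a : ℝ) : Type _ := V

/-- The path metric `θ_a(x, y)`, i.e. the infimum of `∑ ρ_a(x_{i-1}, x_i)` over all finite chains
from `x` to `y`. For admissible `a` one has `θ_a ≤ ρ_a ≤ 2 θ_a`, so that Cauchy
sequences, and their equivalence, are the same for `θ_a` and for `ρ_a`. -/
noncomputable instance (G : SimpleGraph V) (o : V) (a : ℝ) :
    PseudoMetricSpace (MetricVertex G o a) :=
  PseudoMetricSpace.ofPreNNDist (X := V) (rho G o a) (rho_self G o a) (rho_comm G o a)

/-- The completion of the vertex set under the hyperbolic metric. -/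
abbrev HypCompletion (G : SimpleGraph V) (o : V) (a : ℝ) : Type _ :=
  UniformSpace.Completion (MetricVertex G o a)

/-- The canonical map of the vertex set into the completion. -/
noncomputable def toCompletion (G : SimpleGraph V) (o : V) (a : ℝ) (x : V) :
    HypCompletion G o a :=
  UniformSpace.Completion.coe' (α := MetricVertex G o a) x

/-- The hyperbolic boundary: the completion minus the vertices. -/
def HypBoundary (G : SimpleGraph V) (o : V) (a : ℝ) : Type _ :=
  {ξ : HypCompletion G o a // ξ ∉ Set.range (toCompletion G o a)}

/-- The extension of `ρ_a` to the boundary,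
`ρ_a(ξ, η) = liminf ρ_a(x, y)` as the vertices `x`, `y` tend to `ξ`, `η` in the completion.
(As `ρ_a` is comparable to a metric, any other choice of limit points of `ρ_a(x, y)` gives the
same up to a bounded factor.) -/
noncomputable def boundaryRho (G : SimpleGraph V) (o : V) (a : ℝ) (ξ η : HypBoundary G o a) : ℝ :=
  liminf (fun p : V × V => (rho G o a p.1 p.2 : ℝ))
    (comap (toCompletion G o a) (𝓝 ξ.1) ×ˢ comap (toCompletion G o a) (𝓝 η.1))

end RootedGraph

/-! ### Equal-ratio iterated function systems and their augmented trees -/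

/-- An IFS of `m` similitudes `S_i(x) = r R_i x + t_i` on `ℝ^d` with common ratio `r`, where the
`R_i` are orthogonal maps. -/
structure SimilitudeIFS (d m : ℕ) (r : ℝ) where
  /-- the orthogonal parts -/
  R : Fin m → (EuclideanSpace ℝ (Fin d) ≃ₗᵢ[ℝ] EuclideanSpace ℝ (Fin d))
  /-- the translation parts -/
  t : Fin m → EuclideanSpace ℝ (Fin d)

namespace SimilitudeIFS

variable {d m : ℕ} {r : ℝ}

/-- The map `S_i`. -/
noncomputable def map (F : SimilitudeIFS d m r) (i : Fin m) (x : EuclideanSpace ℝ (Fin d)) :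
    EuclideanSpace ℝ (Fin d) :=
  r • F.R i x + F.t i

/-- `S_u = S_{i_1} ∘ ⋯ ∘ S_{i_n}` for the word `u = i_1 ⋯ i_n`. -/
noncomputable def wordMap (F : SimilitudeIFS d m r) (u : List (Fin m))
    (x : EuclideanSpace ℝ (Fin d)) : EuclideanSpace ℝ (Fin d) :=
  u.foldr F.map x

/-- `K` is the self-similar set of the IFS: the nonempty compact set with `K = ⋃ S_i(K)`. -/
def IsSelfSimilarSet (F : SimilitudeIFS d m r) (K : Set (EuclideanSpace ℝ (Fin d))) : Prop :=
  K.Nonempty ∧ IsCompact K ∧ K = ⋃ i, F.map i '' K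

/-- The open set condition. -/
def OSC (F : SimilitudeIFS d m r) : Prop :=
  ∃ U : Set (EuclideanSpace ℝ (Fin d)), U.Nonempty ∧ IsOpen U ∧ (∀ i, F.map i '' U ⊆ U) ∧
    ∀ i j, i ≠ j → Disjoint (F.map i '' U) (F.map j '' U)

/-- Condition (H): there is `c > 0` such that for all words `u`, `v` of the same length `n ≥ 1`,
if `K_u` and `K_v` are disjoint, then `dist (K_u, K_v) ≥ c r ^ n`. -/
def ConditionH (F : SimilitudeIFS d m r) (K : Set (EuclideanSpace ℝ (Fin d))) : Prop :=
  ∃ c : ℝ, 0 < c ∧ ∀ n : ℕ, 1 ≤ n → ∀ u v : List (Fin m), u.length = n → v.length = n →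
    Disjoint (F.wordMap u '' K) (F.wordMap v '' K) →
      ∀ x ∈ F.wordMap u '' K, ∀ y ∈ F.wordMap v '' K, c * r ^ n ≤ dist x y

/-- `J` is a (nonempty) bounded closed invariant set: `S_i(J) ⊆ J` for all `i`. -/
def IsBoundedClosedInvariant (F : SimilitudeIFS d m r)
    (J : Set (EuclideanSpace ℝ (Fin d))) : Prop :=
  J.Nonempty ∧ Bornology.IsBounded J ∧ IsClosed J ∧ ∀ i, F.map i '' J ⊆ J

/-- The vertical edges on the symbolic space of all finite words: they join `u` and `ui`. -/
def verticalGraph (m : ℕ) : SimpleGraph (List (Fin m)) where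
  Adj u v := (∃ i, v = u ++ [i]) ∨ (∃ i, u = v ++ [i])
  symm := ⟨fun _ _ h => h.symm⟩
  loopless := ⟨fun u h => by rcases h with ⟨i, h⟩ | ⟨i, h⟩ <;> simp at h⟩

/-- The horizontal edges with respect to `J`: they join distinct words `u`, `v` of the same length
with `S_u(J) ∩ S_v(J) ≠ ∅`. -/
def horizontalGraph (F : SimilitudeIFS d m r) (J : Set (EuclideanSpace ℝ (Fin d))) :
    SimpleGraph (List (Fin m)) where
  Adj u v := u.length = v.length ∧ u ≠ v ∧ (F.wordMap u '' J ∩ F.wordMap v '' J).Nonempty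
  symm := ⟨fun _ _ h => ⟨h.1.symm, h.2.1.symm, by rw [Set.inter_comm]; exact h.2.2⟩⟩
  loopless := ⟨fun _ h => h.2.1 rfl⟩

/-- The augmented tree; its root is the empty word `[]`. -/
def augmentedTree (F : SimilitudeIFS d m r) (J : Set (EuclideanSpace ℝ (Fin d))) :
    SimpleGraph (List (Fin m)) :=
  verticalGraph m ⊔ F.horizontalGraph J

/-- The horizontal connected components. As horizontal edges stay in one level,
these are the connected components of the graph of horizontal edges. -/
abbrev HorizontalComponent (F : SimilitudeIFS d m r) (J : Set (EuclideanSpace ℝ (Fin d))) :=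
  (F.horizontalGraph J).ConnectedComponent

/-- The set of vertices of `T ∪ TΣ`. -/
def withOffspring (F : SimilitudeIFS d m r) (J : Set (EuclideanSpace ℝ (Fin d)))
    (T : F.HorizontalComponent J) : Set (List (Fin m)) :=
  T.supp ∪ {w | ∃ u ∈ T.supp, ∃ i, w = u ++ [i]}

/-- `T ∼ T'`: there is a bijection from `T ∪ TΣ` onto `T' ∪ T'Σ` that preserves, in both
directions, the vertical and the horizontal edges. -/
def componentSetoid (F : SimilitudeIFS d m r) (J : Set (EuclideanSpace ℝ (Fin d))) :
    Setoid (F.HorizontalComponent J) where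
  r T T' := ∃ g : F.withOffspring J T ≃ F.withOffspring J T', ∀ x y,
    ((verticalGraph m).Adj x.1 y.1 ↔ (verticalGraph m).Adj (g x).1 (g y).1) ∧
    ((F.horizontalGraph J).Adj x.1 y.1 ↔ (F.horizontalGraph J).Adj (g x).1 (g y).1)
  iseqv :=
    { refl := fun _ => ⟨Equiv.refl _, fun _ _ => ⟨Iff.rfl, Iff.rfl⟩⟩
      symm := by
        rintro _ _ ⟨g, hg⟩
        refine ⟨g.symm, fun x y => ?_⟩
        have h := hg (g.symm x) (g.symm y)
        simp only [Equiv.apply_symm_apply] at h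
        exact ⟨h.1.symm, h.2.symm⟩
      trans := by
        rintro _ _ _ ⟨g, hg⟩ ⟨k, hk⟩
        exact ⟨g.trans k, fun x y =>
          ⟨(hg x y).1.trans (hk (g x) (g y)).1, (hg x y).2.trans (hk (g x) (g y)).2⟩⟩ }

/-- The augmented tree defined by `J` is simple: there are finitely many connected classes. -/
def IsSimple (F : SimilitudeIFS d m r) (J : Set (EuclideanSpace ℝ (Fin d))) : Prop :=
  Finite (Quotient (F.componentSetoid J))

end SimilitudeIFS

/-! Fix `x₀ ∈ K` and send a word `u` to the point π(u) = S_u(x₀). Everything rests on one estimate: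
r^|u ∧ v| is comparable to |π(u) - π(v)| + r^|u| + r^|v|. In one direction, an edge at level n moves
π by O(r^n), and a geometric series along a geodesic bounds the sum
(`scaledDist_le_rpow_gromovProduct`). In the other, just past the last level at which the prefixes
of u and v are equal or adjacent, their cells are disjoint and condition (H) separates them
(`exists_rpow_gromovProduct_le`).

The sum obeys the triangle inequality, and this yields hyperbolicity. Moreover ρ_a = (r^|u ∧ v|)^α
off the diagonal, with α = a / (-log r). Towards the boundary the terms r^|u| and r^|v| vanish, so
limits of π give a bijection from ∂X onto K under which ρ_a is comparable to dist^α
(`lipschitzEquivalent_boundary`). As r and a are common to both systems, so is α, and passing to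
α-th powers neither creates nor destroys Lipschitz equivalence. -/

/-! ### Lipschitz equivalence and powers of distances -/

namespace LipschitzEquivalent

variable {A B D : Type*} {dA : A → A → ℝ} {dB : B → B → ℝ} {dD : D → D → ℝ}

theorem symm (h : LipschitzEquivalent dA dB) : LipschitzEquivalent dB dA := by
  obtain ⟨σ, C, hC, h⟩ := h
  refine ⟨σ.symm, C, hC, fun x y => ?_⟩
  obtain ⟨h1, h2⟩ := h (σ.symm x) (σ.symm y)
  simp only [Equiv.apply_symm_apply] at h1 h2
  rw [inv_mul_le_iff₀ hC] at h1 ⊢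
  exact ⟨h2, h1⟩

theorem trans (h : LipschitzEquivalent dA dB) (h' : LipschitzEquivalent dB dD) :
    LipschitzEquivalent dA dD := by
  obtain ⟨σ, C, hC, h⟩ := h
  obtain ⟨τ, C', hC', h'⟩ := h'
  refine ⟨σ.trans τ, C' * C, by positivity, fun x y => ?_⟩
  obtain ⟨h1, h2⟩ := h x y
  obtain ⟨h3, h4⟩ := h' (σ x) (σ y)
  rw [inv_mul_le_iff₀ (by positivity)] at h1 h3 ⊢
  simp only [Equiv.trans_apply]
  refine ⟨h1.trans ?_, h4.trans ?_⟩
  · rw [mul_comm C' C, mul_assoc]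
    gcongr
  · rw [mul_assoc]
    gcongr

theorem rpow (hA : ∀ x y, 0 ≤ dA x y) (hB : ∀ x y, 0 ≤ dB x y) {α : ℝ} (hα : 0 ≤ α)
    (h : LipschitzEquivalent dA dB) :
    LipschitzEquivalent (fun x y => dA x y ^ α) (fun x y => dB x y ^ α) := by
  obtain ⟨σ, C, hC, h⟩ := h
  refine ⟨σ, C ^ α, by positivity, fun x y => ?_⟩
  obtain ⟨h1, h2⟩ := h x y
  rw [inv_mul_le_iff₀ (by positivity)] at h1 ⊢
  rw [← Real.mul_rpow hC.le (hB _ _), ← Real.mul_rpow hC.le (hA _ _)]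
  exact ⟨Real.rpow_le_rpow (hA _ _) h1 hα, Real.rpow_le_rpow (hB _ _) h2 hα⟩

theorem rpow_iff (hA : ∀ x y, 0 ≤ dA x y) (hB : ∀ x y, 0 ≤ dB x y) {α : ℝ} (hα : 0 < α) :
    LipschitzEquivalent (fun x y => dA x y ^ α) (fun x y => dB x y ^ α) ↔
      LipschitzEquivalent dA dB := by
  refine ⟨fun h => ?_, rpow hA hB hα.le⟩
  have := rpow (fun x y => Real.rpow_nonneg (hA x y) α) (fun x y => Real.rpow_nonneg (hB x y) α)
    (inv_nonneg.2 hα.le) h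
  simpa only [Real.rpow_rpow_inv (hA _ _) hα.ne', Real.rpow_rpow_inv (hB _ _) hα.ne'] using this

end LipschitzEquivalent

/-! ### Codings, hyperbolicity and the metric on the vertices -/

namespace RootedGraph

variable {V E : Type*} [MetricSpace E]

/-- The distance of the images of two vertices under `π`, enlarged by the scales of both. -/
noncomputable def scaledDist (π : V → E) (ℓ : V → ℕ) (r : ℝ) (u v : V) : ℝ :=
  dist (π u) (π v) + r ^ ℓ u + r ^ ℓ v

/-- A coding of the points of `K` by the vertices of a rooted graph for which
`r ^ |u ∧ v|` is comparable to the scaled distance of the images of `u` and `v`. -/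
structure IsCoding (G : SimpleGraph V) (o : V) (K : Set E) (r C : ℝ) (π : V → E) (ℓ : V → ℕ) :
    Prop where
  one_le : 1 ≤ C
  mem : ∀ u, π u ∈ K
  scaledDist_le : ∀ u v, scaledDist π ℓ r u v ≤ C * r ^ gromovProduct G o u v
  rpow_le : ∀ u v, r ^ gromovProduct G o u v ≤ C * scaledDist π ℓ r u v
  exists_tendsto : ∀ x ∈ K, ∃ w : ℕ → V, Tendsto (fun n => π (w n)) atTop (𝓝 x) ∧
    Tendsto (fun n => ℓ (w n)) atTop atTop

theorem coe_rho_of_ne (G : SimpleGraph V) (o : V) (a : ℝ) {x y : V} (h : x ≠ y) :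
    (rho G o a x y : ℝ) = Real.exp (-a * gromovProduct G o x y) :=
  congrArg NNReal.toReal (if_neg h)

theorem scaledDist_pos {π : V → E} {ℓ : V → ℕ} {r : ℝ} (hr : 0 < r) (u v : V) :
    0 < scaledDist π ℓ r u v := by
  unfold scaledDist
  positivity

theorem scaledDist_triangle {π : V → E} {ℓ : V → ℕ} {r : ℝ} (hr : 0 < r) (u v w : V) :
    scaledDist π ℓ r u w ≤ scaledDist π ℓ r u v + scaledDist π ℓ r v w := by
  unfold scaledDist
  have := dist_triangle (π u) (π v) (π w)
  have := pow_pos hr (ℓ v)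
  linarith

/-- Exponentiating the hyperbolicity inequality turns the minimum into a maximum and δ into the
factor e^(δa), which admissibility keeps below √2. -/
theorem rho_le_max (G : SimpleGraph V) (o : V) {a δ : ℝ} (ha : 0 < a)
    (h : IsHyperbolicWith G o δ) (hδ : Real.exp (δ * a) - 1 < Real.sqrt 2 - 1)
    (x y z : V) :
    (rho G o a x y : ℝ) ≤ Real.sqrt 2 * max (rho G o a x z : ℝ) (rho G o a z y) := by
  have h1 : (1 : ℝ) ≤ Real.sqrt 2 := by
    rw [Real.one_le_sqrt]; norm_num
  have hle : ∀ t : ℝ≥0, (t : ℝ) ≤ Real.sqrt 2 * t := fun t => le_mul_of_one_le_left t.2 h1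
  by_cases hxy : x = y
  · subst hxy
    rw [rho_self]
    simp only [NNReal.coe_zero]
    positivity
  by_cases hxz : x = z
  · subst hxz
    exact (hle _).trans (by gcongr; exact le_max_right _ _)
  by_cases hzy : z = y
  · subst hzy
    exact (hle _).trans (by gcongr; exact le_max_left _ _)
  rw [coe_rho_of_ne G o a hxy, coe_rho_of_ne G o a hxz, coe_rho_of_ne G o a hzy]
  have key := h x y z
  have hmono : Real.exp (-a * gromovProduct G o x y) ≤ Real.exp (δ * a) *
      Real.exp (-a * min (gromovProduct G o x z) (gromovProduct G o z y)) := by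
    rw [← Real.exp_add, Real.exp_le_exp]
    nlinarith
  refine hmono.trans (mul_le_mul (by linarith) ?_ (by positivity) (by positivity))
  rcases min_cases (gromovProduct G o x z) (gromovProduct G o z y) with ⟨h, -⟩ | ⟨h, -⟩ <;> rw [h]
  · exact le_max_left _ _
  · exact le_max_right _ _

theorem dist_le_rho (G : SimpleGraph V) (o : V) (a : ℝ) (x y : MetricVertex G o a) :
    dist x y ≤ (rho G o a x y : ℝ) :=
  PseudoMetricSpace.dist_ofPreNNDist_le (X := V) _ (rho_self G o a) (rho_comm G o a) x y

/-- Two uses of the √2-inequality cost a factor 2 over chains of three steps, which is exactly the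
hypothesis of the Frink-type chain lemma. -/
theorem IsAdmissible.rho_le_two_mul_dist {G : SimpleGraph V} {o : V} {a : ℝ}
    (h : IsAdmissible G o a) (x y : MetricVertex G o a) :
    (rho G o a x y : ℝ) ≤ 2 * dist x y := by
  obtain ⟨ha, δ, -, hyp, hδ⟩ := h
  refine PseudoMetricSpace.le_two_mul_dist_ofPreNNDist (X := V) _ (rho_self G o a)
    (rho_comm G o a) (fun x₁ x₂ x₃ x₄ => ?_) x y
  rw [← NNReal.coe_le_coe]
  push_cast
  have h1 := rho_le_max G o ha hyp hδ x₁ x₄ x₂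
  have h2 := rho_le_max G o ha hyp hδ x₂ x₄ x₃
  have hs : Real.sqrt 2 * Real.sqrt 2 = 2 := Real.mul_self_sqrt (by norm_num)
  have hs1 : (1 : ℝ) ≤ Real.sqrt 2 := by
    rw [Real.one_le_sqrt]; norm_num
  set m : ℝ := max (rho G o a x₁ x₂ : ℝ) (max (rho G o a x₂ x₃) (rho G o a x₃ x₄))
  have hm : 0 ≤ m := le_max_of_le_left (NNReal.coe_nonneg _)
  have h3 : (rho G o a x₂ x₄ : ℝ) ≤ Real.sqrt 2 * m :=
    h2.trans (by gcongr; exact le_max_right _ _)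
  have h4 : max (rho G o a x₁ x₂ : ℝ) (rho G o a x₂ x₄) ≤ Real.sqrt 2 * m :=
    max_le ((le_max_left _ _).trans (le_mul_of_one_le_left hm hs1)) h3
  calc (rho G o a x₁ x₄ : ℝ) ≤ Real.sqrt 2 * (Real.sqrt 2 * m) := h1.trans (by gcongr)
    _ = 2 * m := by rw [← mul_assoc, hs]

namespace IsCoding

variable {G : SimpleGraph V} {o : V} {K : Set E} {r C : ℝ} {π : V → E} {ℓ : V → ℕ}

theorem isHyperbolic (h : IsCoding G o K r C π ℓ) (hr0 : 0 < r) (hr1 : r < 1) :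
    IsHyperbolic G o := by
  have hC := h.one_le
  -- The triangle inequality for `scaledDist` costs C twice and a sum of two terms costs 2; the
  -- base-r logarithm of 2C² is the resulting loss in the exponent.
  refine ⟨-Real.logb r (2 * C ^ 2), ?_, fun x y z => ?_⟩
  · rw [neg_pos]
    exact Real.logb_neg_of_base_lt_one hr0 hr1 (by nlinarith)
  · rw [← Real.rpow_le_rpow_left_iff_of_base_lt_one hr0 hr1, sub_neg_eq_add,
      Real.rpow_add hr0, Real.rpow_logb hr0 hr1.ne (by positivity)]
    have hmin : ∀ s t : ℝ, r ^ s + r ^ t ≤ 2 * r ^ min s t := by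
      intro s t
      have h1 := Real.rpow_le_rpow_of_exponent_ge hr0 hr1.le (min_le_left s t)
      have h2 := Real.rpow_le_rpow_of_exponent_ge hr0 hr1.le (min_le_right s t)
      linarith
    calc r ^ gromovProduct G o x y ≤ C * scaledDist π ℓ r x y := h.rpow_le x y
      _ ≤ C * (scaledDist π ℓ r x z + scaledDist π ℓ r z y) := by
          gcongr
          exact scaledDist_triangle hr0 x z y
      _ ≤ C * (C * r ^ gromovProduct G o x z + C * r ^ gromovProduct G o z y) := by
          gcongr
          · exact h.scaledDist_le x z
          · exact h.scaledDist_le z y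
      _ = C ^ 2 * (r ^ gromovProduct G o x z + r ^ gromovProduct G o z y) := by ring
      _ ≤ C ^ 2 * (2 * r ^ min (gromovProduct G o x z) (gromovProduct G o z y)) := by
          gcongr
          exact hmin _ _
      _ = _ := by ring

variable {a : ℝ}

theorem exp_eq_rpow (hr0 : 0 < r) (hr1 : r < 1) (g : ℝ) :
    Real.exp (-a * g) = (r ^ g) ^ (a / -Real.log r) := by
  have hlog := Real.log_neg hr0 hr1
  rw [← Real.rpow_mul hr0.le, Real.rpow_def_of_pos hr0]
  congr 1
  field_simp [hlog.ne]

theorem rho_le (h : IsCoding G o K r C π ℓ) (hr0 : 0 < r) (hr1 : r < 1) (ha : 0 < a) (u v : V) :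
    (rho G o a u v : ℝ) ≤
      C ^ (a / -Real.log r) * scaledDist π ℓ r u v ^ (a / -Real.log r) := by
  have hC := h.one_le
  have hq := scaledDist_pos (π := π) (ℓ := ℓ) hr0 u v
  have hα : 0 < a / -Real.log r := div_pos ha (neg_pos.2 (Real.log_neg hr0 hr1))
  by_cases huv : u = v
  · rw [huv, rho_self, ← huv, NNReal.coe_zero]
    exact mul_nonneg (by positivity) (Real.rpow_nonneg (scaledDist_pos hr0 u u).le _)
  · rw [coe_rho_of_ne G o a huv, exp_eq_rpow hr0 hr1, ← Real.mul_rpow (by positivity) hq.le]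
    exact Real.rpow_le_rpow (by positivity) (h.rpow_le u v) hα.le

theorem le_rho (h : IsCoding G o K r C π ℓ) (hr0 : 0 < r) (hr1 : r < 1) (ha : 0 < a) {u v : V}
    (huv : u ≠ v) :
    scaledDist π ℓ r u v ^ (a / -Real.log r) ≤ C ^ (a / -Real.log r) * (rho G o a u v : ℝ) := by
  have hC := h.one_le
  have hα : 0 < a / -Real.log r := div_pos ha (neg_pos.2 (Real.log_neg hr0 hr1))
  rw [coe_rho_of_ne G o a huv, exp_eq_rpow hr0 hr1, ← Real.mul_rpow (by positivity) (by positivity)]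
  exact Real.rpow_le_rpow (scaledDist_pos hr0 u v).le (h.scaledDist_le u v) hα.le

/-- A vertex is isolated, at a distance controlled by its level. -/
theorem pow_le_dist (h : IsCoding G o K r C π ℓ) (hr0 : 0 < r) (hr1 : r < 1)
    (ha : IsAdmissible G o a) {u v : MetricVertex G o a} (huv : u ≠ v) {N : ℕ} (hN : ℓ u ≤ N) :
    (r ^ N) ^ (a / -Real.log r) ≤ C ^ (a / -Real.log r) * (2 * dist u v) := by
  have hC := h.one_le
  have hα : 0 < a / -Real.log r := div_pos ha.1 (neg_pos.2 (Real.log_neg hr0 hr1))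
  calc (r ^ N) ^ (a / -Real.log r) ≤ scaledDist π ℓ r u v ^ (a / -Real.log r) := by
        refine Real.rpow_le_rpow (by positivity) ?_ hα.le
        have h1 := pow_le_pow_of_le_one hr0.le hr1.le hN
        have h2 : 0 < r ^ ℓ v := by positivity
        have h3 := dist_nonneg (x := π u) (y := π v)
        unfold scaledDist
        linarith
    _ ≤ _ := h.le_rho hr0 hr1 ha.1 huv
    _ ≤ _ := by
        gcongr
        exact ha.rho_le_two_mul_dist u v

/-- This lets π extend to the completion, hence to the boundary. -/
theorem uniformContinuous (h : IsCoding G o K r C π ℓ) (hr0 : 0 < r) (hr1 : r < 1)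
    (ha : IsAdmissible G o a) : UniformContinuous (α := MetricVertex G o a) π := by
  have hC := h.one_le
  have hα : 0 < a / -Real.log r := div_pos ha.1 (neg_pos.2 (Real.log_neg hr0 hr1))
  refine Metric.uniformContinuous_iff.2 fun ε hε => ⟨ε ^ (a / -Real.log r) / (2 * C ^ (a / -Real.log r)), by positivity,
    fun {u v} huv => ?_⟩
  by_cases hne : u = v
  · rw [hne, dist_self]
    exact hε
  rw [lt_div_iff₀ (by positivity)] at huv
  have h1 : scaledDist π ℓ r u v ^ (a / -Real.log r) < ε ^ (a / -Real.log r) := by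
    refine (h.le_rho hr0 hr1 ha.1 hne).trans_lt (lt_of_le_of_lt ?_ huv)
    have := ha.rho_le_two_mul_dist u v
    calc _ ≤ C ^ (a / -Real.log r) * (2 * dist u v) := by gcongr
      _ = _ := by ring
  replace h1 := (Real.rpow_lt_rpow_iff (scaledDist_pos hr0 _ _).le hε.le hα).1 h1
  have h2 := pow_pos hr0 (ℓ u)
  have h3 := pow_pos hr0 (ℓ v)
  unfold scaledDist at h1
  linarith

end IsCoding

/-! ### The boundary as a snowflake of the coded set -/

/-- The trace on the vertices of the neighbourhoods of a point of the completion. -/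
noncomputable def vertexFilter (G : SimpleGraph V) (o : V) (a : ℝ) (ξ : HypCompletion G o a) :
    Filter V :=
  comap (toCompletion G o a) (𝓝 ξ)

instance (G : SimpleGraph V) (o : V) (a : ℝ) (ξ : HypCompletion G o a) :
    (vertexFilter G o a ξ).NeBot :=
  (UniformSpace.Completion.isDenseInducing_coe (α := MetricVertex G o a)).comap_nhds_neBot ξ

theorem tendsto_toCompletion (G : SimpleGraph V) (o : V) (a : ℝ) (ξ : HypCompletion G o a) :
    Tendsto (toCompletion G o a) (vertexFilter G o a ξ) (𝓝 ξ) :=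
  tendsto_comap

theorem dist_toCompletion (G : SimpleGraph V) (o : V) (a : ℝ) (u v : V) :
    dist (toCompletion G o a u) (toCompletion G o a v) =
      dist (α := MetricVertex G o a) u v :=
  UniformSpace.Completion.dist_eq (α := MetricVertex G o a) u v

theorem tendsto_dist_vertexFilter (G : SimpleGraph V) (o : V) (a : ℝ)
    (ξ η : HypCompletion G o a) :
    Tendsto (fun p : V × V => dist (α := MetricVertex G o a) p.1 p.2)
      (vertexFilter G o a ξ ×ˢ vertexFilter G o a η) (𝓝 (dist ξ η)) := by
  have := ((tendsto_toCompletion G o a ξ).comp tendsto_fst).dist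
    ((tendsto_toCompletion G o a η).comp
      (tendsto_snd (f := vertexFilter G o a ξ) (g := vertexFilter G o a η)))
  simpa only [Function.comp_apply, dist_toCompletion] using this

theorem boundaryRho_eq (G : SimpleGraph V) (o : V) (a : ℝ) (ξ η : HypBoundary G o a) :
    boundaryRho G o a ξ η = liminf (fun p : V × V => (rho G o a p.1 p.2 : ℝ))
      (vertexFilter G o a ξ.1 ×ˢ vertexFilter G o a η.1) := rfl

namespace IsCoding

variable {G : SimpleGraph V} {o : V} {K : Set E} {r C a : ℝ} {π : V → E} {ℓ : V → ℕ}

/-- Vertices of level at most N are isolated with a radius depending only on N. If they kept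
occurring near ξ, a small neighbourhood of ξ would contain just one vertex, and ξ would be that
vertex. -/
theorem tendsto_level (h : IsCoding G o K r C π ℓ) (hr0 : 0 < r) (hr1 : r < 1)
    (ha : IsAdmissible G o a) (ξ : HypBoundary G o a) :
    Tendsto ℓ (vertexFilter G o a ξ.1) atTop := by
  have hC := h.one_le
  rw [tendsto_atTop]
  intro N
  by_contra hN
  have hε : 0 < (r ^ N) ^ (a / -Real.log r) / (C ^ (a / -Real.log r) * 2) := by positivity
  have hlim := tendsto_dist_vertexFilter G o a ξ.1 ξ.1
  rw [dist_self] at hlim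
  obtain ⟨t, ht, hdist⟩ := eventually_prod_self_iff'.1 (hlim.eventually_lt_const hε)
  obtain ⟨u, hu, hut⟩ := ((not_eventually.1 hN).and_eventually ht).exists
  have hconst : ∀ v ∈ t, v = u := by
    intro v hv
    by_contra hne
    have h1 := h.pow_le_dist hr0 hr1 ha (u := u) (v := v) (Ne.symm hne) (not_le.1 hu).le
    have h2 := hdist u hut v hv
    rw [lt_div_iff₀ (by positivity)] at h2
    linarith
  refine ξ.2 ⟨u, tendsto_nhds_unique (Tendsto.congr' ?_ tendsto_const_nhds)
    (tendsto_toCompletion G o a ξ.1)⟩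
  filter_upwards [ht] with v hv
  rw [hconst v hv]

theorem exists_tendsto_boundary [CompleteSpace E] (h : IsCoding G o K r C π ℓ) (hr0 : 0 < r)
    (hr1 : r < 1) (ha : IsAdmissible G o a) (hK : IsClosed K) (ξ : HypBoundary G o a) :
    ∃ x : K, Tendsto π (vertexFilter G o a ξ.1) (𝓝 (x : E)) := by
  have hu := h.uniformContinuous hr0 hr1 ha
  have hlim : Tendsto π (vertexFilter G o a ξ.1)
      (𝓝 (UniformSpace.Completion.extension (α := MetricVertex G o a) π ξ.1)) := by
    refine ((UniformSpace.Completion.continuous_extension.tendsto ξ.1).comp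
      (tendsto_toCompletion G o a ξ.1)).congr fun u => ?_
    exact UniformSpace.Completion.extension_coe hu u
  exact ⟨⟨_, hK.mem_of_tendsto hlim (Eventually.of_forall h.mem)⟩, hlim⟩

theorem tendsto_scaledDist (h : IsCoding G o K r C π ℓ) (hr0 : 0 < r) (hr1 : r < 1)
    (ha : IsAdmissible G o a) {ξ η : HypBoundary G o a} {x y : E}
    (hx : Tendsto π (vertexFilter G o a ξ.1) (𝓝 x))
    (hy : Tendsto π (vertexFilter G o a η.1) (𝓝 y)) :
    Tendsto (fun p : V × V => scaledDist π ℓ r p.1 p.2)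
      (vertexFilter G o a ξ.1 ×ˢ vertexFilter G o a η.1) (𝓝 (dist x y)) := by
  have hpow := tendsto_pow_atTop_nhds_zero_of_lt_one hr0.le hr1
  have := (((hx.comp tendsto_fst).dist (hy.comp tendsto_snd)).add
    (hpow.comp ((h.tendsto_level hr0 hr1 ha ξ).comp tendsto_fst))).add
    (hpow.comp ((h.tendsto_level hr0 hr1 ha η).comp tendsto_snd))
  simpa only [add_zero, Function.comp_def, scaledDist] using this

/-- Surjectivity of the boundary map: a sequence of vertices coding x is Cauchy because its scaled
distances tend to 0. -/
theorem exists_boundary_tendsto (h : IsCoding G o K r C π ℓ) (hr0 : 0 < r) (hr1 : r < 1)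
    (ha : IsAdmissible G o a) (x : K) :
    ∃ ξ : HypBoundary G o a,
      ∃ w : ℕ → V, Tendsto w atTop (vertexFilter G o a ξ.1) ∧
        Tendsto (fun n => π (w n)) atTop (𝓝 (x : E)) := by
  have hC := h.one_le
  have hα : 0 < a / -Real.log r := div_pos ha.1 (neg_pos.2 (Real.log_neg hr0 hr1))
  obtain ⟨w, hw, hℓ⟩ := h.exists_tendsto x x.2
  have hpow := (tendsto_pow_atTop_nhds_zero_of_lt_one hr0.le hr1).comp hℓ
  have hq : Tendsto (fun p : ℕ × ℕ => C ^ (a / -Real.log r) *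
      scaledDist π ℓ r (w p.1) (w p.2) ^ (a / -Real.log r)) (atTop ×ˢ atTop) (𝓝 0) := by
    have h1 := (((hw.comp tendsto_fst).dist (hw.comp tendsto_snd)).add
      (hpow.comp tendsto_fst)).add (hpow.comp (tendsto_snd (f := atTop) (g := atTop)))
    have h2 := (h1.rpow_const (p := a / -Real.log r) (Or.inr hα.le)).const_mul
      (C ^ (a / -Real.log r))
    simpa only [dist_self, add_zero, Real.zero_rpow hα.ne', mul_zero, Function.comp_def,
      scaledDist] using h2
  have hcau : CauchySeq fun n => toCompletion G o a (w n) := by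
    rw [Metric.cauchySeq_iff']
    intro ε hε
    rw [prod_atTop_atTop_eq] at hq
    obtain ⟨N, hN⟩ := eventually_atTop.1 (hq.eventually_lt_const hε)
    refine ⟨max N.1 N.2, fun n hn => ?_⟩
    rw [dist_toCompletion]
    refine (dist_le_rho G o a _ _).trans_lt ((h.rho_le hr0 hr1 ha.1 _ _).trans_lt ?_)
    exact hN (n, max N.1 N.2) ⟨(le_max_left _ _).trans hn, le_max_right _ _⟩
  obtain ⟨ξ, hξ⟩ := cauchySeq_tendsto_of_complete hcau
  refine ⟨⟨ξ, ?_⟩, w, tendsto_comap_iff.2 hξ, hw⟩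
  -- The limit is not a vertex u: u is isolated, while the levels along the sequence eventually
  -- exceed that of u.
  rintro ⟨u, rfl⟩
  have hdist : Tendsto (fun n => dist (α := MetricVertex G o a) u (w n)) atTop (𝓝 0) := by
    have := (tendsto_const_nhds (x := toCompletion G o a u)).dist hξ
    simpa only [dist_toCompletion, dist_self] using this
  have hε : 0 < (r ^ ℓ u) ^ (a / -Real.log r) / (C ^ (a / -Real.log r) * 2) := by positivity
  obtain ⟨n, hn, hne⟩ := ((hdist.eventually_lt_const hε).and
    (hℓ.eventually_gt_atTop (ℓ u))).exists
  have h1 := h.pow_le_dist hr0 hr1 ha (u := u) (v := w n) (by rintro rfl; exact lt_irrefl _ hne)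
    le_rfl
  rw [lt_div_iff₀ (by positivity)] at hn
  linarith

theorem eventually_ne {ξ η : HypBoundary G o a} (hne : ξ ≠ η) :
    ∀ᶠ p : V × V in vertexFilter G o a ξ.1 ×ˢ vertexFilter G o a η.1, p.1 ≠ p.2 := by
  have hpos : 0 < dist ξ.1 η.1 := dist_pos.2 fun h => hne (Subtype.ext h)
  filter_upwards [(tendsto_dist_vertexFilter G o a ξ.1 η.1).eventually_const_lt hpos]
    with p hp heq
  refine hp.ne' ?_
  rw [heq]
  exact dist_self (α := MetricVertex G o a) p.2

theorem boundaryRho_nonneg (ξ η : HypBoundary G o a) : 0 ≤ boundaryRho G o a ξ η := by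
  -- The real liminf is the supremum of the eventual lower bounds, and 0 is one of them; were they
  -- unbounded, the default value 0 would still do.
  refine Real.sSup_nonneg' ⟨0, ?_, le_rfl⟩
  simp only [Set.mem_ofPred_eq, eventually_map]
  exact Eventually.of_forall fun p => NNReal.coe_nonneg _

theorem boundaryRho_le (h : IsCoding G o K r C π ℓ) (hr0 : 0 < r) (hr1 : r < 1)
    (ha : IsAdmissible G o a) {ξ η : HypBoundary G o a} {x y : E}
    (hx : Tendsto π (vertexFilter G o a ξ.1) (𝓝 x))
    (hy : Tendsto π (vertexFilter G o a η.1) (𝓝 y)) :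
    boundaryRho G o a ξ η ≤ C ^ (a / -Real.log r) * dist x y ^ (a / -Real.log r) := by
  have hα : 0 < a / -Real.log r := div_pos ha.1 (neg_pos.2 (Real.log_neg hr0 hr1))
  have hlim := ((h.tendsto_scaledDist hr0 hr1 ha hx hy).rpow_const (p := a / -Real.log r)
    (Or.inr hα.le)).const_mul (C ^ (a / -Real.log r))
  rw [boundaryRho_eq, ← hlim.liminf_eq]
  exact liminf_le_liminf (Eventually.of_forall fun p => h.rho_le hr0 hr1 ha.1 p.1 p.2)
    (isBoundedUnder_of ⟨0, fun p => NNReal.coe_nonneg _⟩) hlim.isCoboundedUnder_ge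

theorem le_boundaryRho (h : IsCoding G o K r C π ℓ) (hr0 : 0 < r) (hr1 : r < 1)
    (ha : IsAdmissible G o a) {ξ η : HypBoundary G o a} (hne : ξ ≠ η) {x y : E}
    (hx : Tendsto π (vertexFilter G o a ξ.1) (𝓝 x))
    (hy : Tendsto π (vertexFilter G o a η.1) (𝓝 y)) :
    (C ^ (a / -Real.log r))⁻¹ * dist x y ^ (a / -Real.log r) ≤ boundaryRho G o a ξ η := by
  have hC := h.one_le
  have hα : 0 < a / -Real.log r := div_pos ha.1 (neg_pos.2 (Real.log_neg hr0 hr1))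
  have hpow := (h.tendsto_scaledDist hr0 hr1 ha hx hy).rpow_const (p := a / -Real.log r)
    (Or.inr hα.le)
  have hlim := hpow.const_mul (C ^ (a / -Real.log r))⁻¹
  have hbdd := (hpow.const_mul (C ^ (a / -Real.log r))).isBoundedUnder_le
  rw [boundaryRho_eq, ← hlim.liminf_eq]
  -- A real liminf is monotone only under boundedness conditions; the upper estimate `rho_le`
  -- supplies the one for ρ_a.
  refine liminf_le_liminf ?_ hlim.isBoundedUnder_ge
    (hbdd.mono_le (Eventually.of_forall fun p =>
      h.rho_le hr0 hr1 ha.1 p.1 p.2)).isCoboundedUnder_ge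
  -- Coinciding vertices, where ρ_a = 0, must be avoided for the lower estimate.
  filter_upwards [eventually_ne hne] with p hp
  rw [inv_mul_le_iff₀ (by positivity)]
  exact h.le_rho hr0 hr1 ha.1 hp

theorem eq_of_tendsto (h : IsCoding G o K r C π ℓ) (hr0 : 0 < r) (hr1 : r < 1)
    (ha : IsAdmissible G o a) {ξ η : HypBoundary G o a} {x : E}
    (hx : Tendsto π (vertexFilter G o a ξ.1) (𝓝 x))
    (hy : Tendsto π (vertexFilter G o a η.1) (𝓝 x)) : ξ = η := by
  have hα : 0 < a / -Real.log r := div_pos ha.1 (neg_pos.2 (Real.log_neg hr0 hr1))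
  have hlim := ((h.tendsto_scaledDist hr0 hr1 ha hx hy).rpow_const (p := a / -Real.log r)
    (Or.inr hα.le)).const_mul (C ^ (a / -Real.log r))
  rw [dist_self, Real.zero_rpow hα.ne', mul_zero] at hlim
  have := le_of_tendsto_of_tendsto' (tendsto_dist_vertexFilter G o a ξ.1 η.1) hlim fun p =>
    (dist_le_rho G o a p.1 p.2).trans (h.rho_le hr0 hr1 ha.1 p.1 p.2)
  exact Subtype.ext (dist_le_zero.1 this)

/-- The hyperbolic boundary is a snowflake copy of the coded set. -/
theorem lipschitzEquivalent_boundary [CompleteSpace E] (h : IsCoding G o K r C π ℓ) (hr0 : 0 < r)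
    (hr1 : r < 1) (ha : IsAdmissible G o a) (hK : IsClosed K) :
    LipschitzEquivalent (boundaryRho G o a)
      (fun x y : K => dist x y ^ (a / -Real.log r)) := by
  have hC := h.one_le
  have hα : 0 < a / -Real.log r := div_pos ha.1 (neg_pos.2 (Real.log_neg hr0 hr1))
  choose φ hφ using h.exists_tendsto_boundary hr0 hr1 ha hK
  have hinj : Function.Injective φ := fun ξ η hξη =>
    h.eq_of_tendsto hr0 hr1 ha (hφ ξ) (hξη ▸ hφ η)
  have hsurj : Function.Surjective φ := fun x => by
    obtain ⟨ξ, w, hw, hx⟩ := h.exists_boundary_tendsto hr0 hr1 ha x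
    exact ⟨ξ, Subtype.ext (tendsto_nhds_unique ((hφ ξ).comp hw) hx)⟩
  refine ⟨Equiv.ofBijective φ ⟨hinj, hsurj⟩, C ^ (a / -Real.log r), by positivity,
    fun ξ η => ?_⟩
  simp only
  rw [inv_mul_le_iff₀ (by positivity)]
  refine ⟨h.boundaryRho_le hr0 hr1 ha (hφ ξ) (hφ η), ?_⟩
  by_cases hne : ξ = η
  · rw [hne, dist_self, Real.zero_rpow hα.ne']
    refine mul_nonneg (by positivity) (boundaryRho_nonneg η η)
  · rw [← inv_mul_le_iff₀ (by positivity)]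
    exact h.le_boundaryRho hr0 hr1 ha hne (hφ ξ) (hφ η)

end IsCoding
end RootedGraph

/-! ### Words, cells and the self-similar set -/

namespace SimilitudeIFS

variable {d m : ℕ} {r : ℝ} (F : SimilitudeIFS d m r) {K J : Set (EuclideanSpace ℝ (Fin d))}

theorem dist_map (hr : 0 ≤ r) (i : Fin m) (x y : EuclideanSpace ℝ (Fin d)) :
    dist (F.map i x) (F.map i y) = r * dist x y := by
  simp only [map, dist_add_right, dist_smul₀, Real.norm_of_nonneg hr, LinearIsometryEquiv.dist_map]

theorem wordMap_cons (i : Fin m) (u : List (Fin m)) (x : EuclideanSpace ℝ (Fin d)) :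
    F.wordMap (i :: u) x = F.map i (F.wordMap u x) := rfl

theorem wordMap_append (u v : List (Fin m)) (x : EuclideanSpace ℝ (Fin d)) :
    F.wordMap (u ++ v) x = F.wordMap u (F.wordMap v x) :=
  List.foldr_append

theorem dist_wordMap (hr : 0 ≤ r) (u : List (Fin m)) (x y : EuclideanSpace ℝ (Fin d)) :
    dist (F.wordMap u x) (F.wordMap u y) = r ^ u.length * dist x y := by
  induction u with
  | nil => simp [wordMap]
  | cons i u ih =>
    rw [wordMap_cons, wordMap_cons, dist_map F hr, ih, List.length_cons, pow_succ]
    ring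

theorem wordMap_mem {A : Set (EuclideanSpace ℝ (Fin d))} (hA : ∀ i, F.map i '' A ⊆ A)
    (u : List (Fin m)) {x : EuclideanSpace ℝ (Fin d)} (hx : x ∈ A) : F.wordMap u x ∈ A := by
  induction u with
  | nil => exact hx
  | cons i u ih => exact hA i ⟨_, ih, rfl⟩

variable {F}

theorem IsSelfSimilarSet.map_subset (hK : F.IsSelfSimilarSet K) (i : Fin m) :
    F.map i '' K ⊆ K := by
  conv_rhs => rw [hK.2.2]
  exact Set.subset_iUnion (fun i => F.map i '' K) i

theorem IsSelfSimilarSet.exists_word (hK : F.IsSelfSimilarSet K) (n : ℕ)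
    {x : EuclideanSpace ℝ (Fin d)} (hx : x ∈ K) :
    ∃ u : List (Fin m), u.length = n ∧ x ∈ F.wordMap u '' K := by
  induction n generalizing x with
  | zero => exact ⟨[], rfl, x, hx, rfl⟩
  | succ n ih =>
    rw [hK.2.2] at hx
    obtain ⟨i, y, hy, rfl⟩ := Set.mem_iUnion.1 hx
    obtain ⟨u, hu, z, hz, rfl⟩ := ih hy
    exact ⟨i :: u, by simp [hu], z, hz, rfl⟩

/-- A point x of K lies in cells K_u with |u| = n, and S_u(z) with z in J stays in J at distance
O(r^n) from x. -/
theorem IsSelfSimilarSet.subset_of_isBoundedClosedInvariant (hr0 : 0 < r) (hr1 : r < 1)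
    (hK : F.IsSelfSimilarSet K) (hJ : F.IsBoundedClosedInvariant J) : K ⊆ J := by
  intro x hx
  obtain ⟨⟨z, hz⟩, hJb, hJc, hJi⟩ := hJ
  obtain ⟨M, hM⟩ := Metric.isBounded_iff.1 (hK.2.1.isBounded.union hJb)
  choose u hu y hy hxy using fun n => hK.exists_word n hx
  have hlim : Tendsto (fun n => F.wordMap (u n) z) atTop (𝓝 x) := by
    rw [tendsto_iff_dist_tendsto_zero]
    have h0 : Tendsto (fun n => r ^ n * M) atTop (𝓝 0) := by
      simpa using (tendsto_pow_atTop_nhds_zero_of_lt_one hr0.le hr1).mul_const M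
    refine squeeze_zero (fun n => dist_nonneg) (fun n => ?_) h0
    rw [← hxy n, dist_wordMap F hr0.le, hu n]
    gcongr
    exact hM (Or.inr hz) (Or.inl (hy n))
  exact hJc.mem_of_tendsto hlim (Eventually.of_forall fun n => wordMap_mem F hJi _ hz)

/-! ### Distances in the augmented tree -/

variable (F J)

theorem adj_append (u : List (Fin m)) (i : Fin m) : (F.augmentedTree J).Adj u (u ++ [i]) :=
  Or.inl (Or.inl ⟨i, rfl⟩)

theorem exists_walk_append (u w : List (Fin m)) :
    ∃ p : (F.augmentedTree J).Walk u (u ++ w), p.length = w.length := by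
  induction w generalizing u with
  | nil => exact ⟨SimpleGraph.Walk.nil.copy rfl (by simp), by simp⟩
  | cons i w ih =>
    obtain ⟨p, hp⟩ := ih (u ++ [i])
    exact ⟨(SimpleGraph.Walk.cons (adj_append F J u i) p).copy rfl (by simp), by simp [hp]⟩

theorem augmentedTree_connected : (F.augmentedTree J).Connected := by
  have h : ∀ u, (F.augmentedTree J).Reachable [] u := fun u => by
    obtain ⟨p, -⟩ := exists_walk_append F J [] u
    exact ⟨p⟩
  exact { preconnected := fun u v => (h u).symm.trans (h v), nonempty := ⟨[]⟩ }

variable {F J}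

theorem length_le_of_adj {u v : List (Fin m)} (h : (F.augmentedTree J).Adj u v) :
    u.length ≤ v.length + 1 := by
  rcases h with (⟨i, rfl⟩ | ⟨i, rfl⟩) | h
  · simp only [List.length_append, List.length_singleton]; lia
  · simp
  · have := h.1; lia

theorem length_le_add_walk_length {u v : List (Fin m)} (p : (F.augmentedTree J).Walk u v) :
    u.length ≤ v.length + p.length := by
  induction p with
  | nil => simp
  | cons h p ih =>
    have := length_le_of_adj h
    rw [SimpleGraph.Walk.length_cons]
    lia

theorem length_le_add_dist (u v : List (Fin m)) :
    u.length ≤ v.length + (F.augmentedTree J).dist u v := by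
  obtain ⟨p, hp⟩ := (augmentedTree_connected F J).exists_walk_length_eq_dist u v
  rw [← hp]
  exact length_le_add_walk_length p

theorem dist_append_le (u w : List (Fin m)) :
    (F.augmentedTree J).dist u (u ++ w) ≤ w.length := by
  obtain ⟨p, hp⟩ := exists_walk_append F J u w
  exact hp ▸ SimpleGraph.dist_le p

theorem dist_root (u : List (Fin m)) : (F.augmentedTree J).dist [] u = u.length := by
  refine le_antisymm (dist_append_le [] u) ?_
  have := length_le_add_dist (F := F) (J := J) u []
  rw [SimpleGraph.dist_comm]
  simpa using this

theorem gromovProduct_eq (u v : List (Fin m)) :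
    RootedGraph.gromovProduct (F.augmentedTree J) [] u v =
      ((u.length : ℝ) + v.length - (F.augmentedTree J).dist u v) / 2 := by
  rw [RootedGraph.gromovProduct, dist_root, dist_root]

/-- Climb from u to level n, cross at most one edge, descend to v. -/
theorem dist_le_of_take {u v : List (Fin m)} {n : ℕ} (hu : n ≤ u.length) (hv : n ≤ v.length)
    (h : (F.augmentedTree J).dist (u.take n) (v.take n) ≤ 1) :
    (F.augmentedTree J).dist u v + 2 * n ≤ u.length + v.length + 1 := by
  have hc := augmentedTree_connected F J
  have h1 : ∀ w : List (Fin m), (F.augmentedTree J).dist (w.take n) w ≤ w.length - n := by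
    intro w
    have := dist_append_le (F := F) (J := J) (w.take n) (w.drop n)
    rwa [List.take_append_drop, List.length_drop] at this
  have h2 := hc.dist_triangle (u := u) (v := u.take n) (w := v)
  have h3 := hc.dist_triangle (u := u.take n) (v := v.take n) (w := v)
  have h4 := h1 u
  have h5 := h1 v
  rw [SimpleGraph.dist_comm (u := u) (v := u.take n)] at h2
  lia

/-! ### Comparison of the Gromov product with the Euclidean distance -/

/-- The 2 accounts for horizontal edges, which cross two cells. The factor r on the left accounts
for edges to the parent, whose cell is larger by 1/r. -/
theorem dist_wordMap_le_of_adj (hr0 : 0 < r) (hr1 : r < 1) {M : ℝ}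
    (hJi : ∀ i, F.map i '' J ⊆ J) (hM : ∀ x ∈ J, ∀ y ∈ J, dist x y ≤ M)
    {x₀ : EuclideanSpace ℝ (Fin d)} (hx₀ : x₀ ∈ J) {u v : List (Fin m)}
    (h : (F.augmentedTree J).Adj u v) :
    dist (F.wordMap u x₀) (F.wordMap v x₀) * r ≤ 2 * M * r ^ u.length := by
  have hM0 : 0 ≤ M := dist_nonneg.trans (hM x₀ hx₀ x₀ hx₀)
  have hchild : ∀ (w : List (Fin m)) (i : Fin m),
      dist (F.wordMap w x₀) (F.wordMap (w ++ [i]) x₀) ≤ M * r ^ w.length := by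
    intro w i
    rw [wordMap_append, dist_wordMap F hr0.le, mul_comm]
    gcongr
    exact hM _ hx₀ _ (wordMap_mem F hJi _ hx₀)
  have hp := pow_pos hr0 u.length
  rcases h with (⟨i, rfl⟩ | ⟨i, rfl⟩) | ⟨hl, -, z, ⟨a, ha, rfl⟩, b, hb, hab⟩
  · have := hchild u i
    have h0 := dist_nonneg (x := F.wordMap u x₀) (y := F.wordMap (u ++ [i]) x₀)
    nlinarith [mul_nonneg hM0 hp.le]
  · have := hchild v i
    rw [dist_comm, List.length_append, List.length_singleton, pow_succ]
    have h0 := mul_nonneg (mul_nonneg hM0 (pow_pos hr0 v.length).le) hr0.le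
    nlinarith
  · have h1 : dist (F.wordMap u x₀) (F.wordMap u a) ≤ r ^ u.length * M := by
      rw [dist_wordMap F hr0.le]
      gcongr
      exact hM _ hx₀ _ ha
    have h2 : dist (F.wordMap v b) (F.wordMap v x₀) ≤ r ^ u.length * M := by
      rw [dist_wordMap F hr0.le, ← hl]
      gcongr
      exact hM _ hb _ hx₀
    rw [hab] at h2
    have h3 := dist_triangle (F.wordMap u x₀) (F.wordMap u a) (F.wordMap v x₀)
    have h0 := dist_nonneg (x := F.wordMap u x₀) (y := F.wordMap v x₀)
    nlinarith

/-- The worst walk climbs at every step, giving a geometric series; its closed form is what the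
induction carries. Real exponents are used since the level minus the length may be negative. -/
theorem dist_wordMap_le_of_walk (hr0 : 0 < r) (hr1 : r < 1) {M : ℝ}
    (hJi : ∀ i, F.map i '' J ⊆ J) (hM : ∀ x ∈ J, ∀ y ∈ J, dist x y ≤ M)
    {x₀ : EuclideanSpace ℝ (Fin d)} (hx₀ : x₀ ∈ J) {u v : List (Fin m)}
    (p : (F.augmentedTree J).Walk u v) :
    dist (F.wordMap u x₀) (F.wordMap v x₀) ≤
      2 * M / (1 - r) * (r ^ ((u.length : ℝ) - p.length) - r ^ (u.length : ℝ)) := by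
  have hM0 : 0 ≤ M := dist_nonneg.trans (hM x₀ hx₀ x₀ hx₀)
  have hr1' : 0 < 1 - r := sub_pos.2 hr1
  induction p with
  | nil => simp
  | @cons u w v h p ih =>
    have hstep := dist_wordMap_le_of_adj hr0 hr1 hJi hM hx₀ h
    rw [← le_div_iff₀ hr0] at hstep
    have htri := dist_triangle (F.wordMap u x₀) (F.wordMap w x₀) (F.wordMap v x₀)
    have hlev : (u.length : ℝ) - 1 ≤ w.length := by
      have := length_le_of_adj h
      rw [sub_le_iff_le_add]
      exact_mod_cast this
    have hk : (0 : ℝ) ≤ p.length := Nat.cast_nonneg _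
    have hone : 1 ≤ r ^ (-(p.length : ℝ)) :=
      Real.one_le_rpow_of_pos_of_le_one_of_nonpos hr0 hr1.le (by linarith)
    have hmono := Real.rpow_le_rpow_of_exponent_ge hr0 hr1.le hlev
    -- Both sides have the form r^s (r^(-k) - 1) with a nonnegative second factor, so lowering the
    -- level s to |u| - 1 only increases the value.
    have hdiff : r ^ ((w.length : ℝ) - p.length) - r ^ (w.length : ℝ) ≤
        r ^ ((u.length : ℝ) - (p.length + 1)) - r ^ ((u.length : ℝ) - 1) := by
      have e1 : r ^ ((w.length : ℝ) - p.length) =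
          r ^ (w.length : ℝ) * r ^ (-(p.length : ℝ)) := by
        rw [← Real.rpow_add hr0, sub_eq_add_neg]
      have e2 : r ^ ((u.length : ℝ) - (p.length + 1)) =
          r ^ ((u.length : ℝ) - 1) * r ^ (-(p.length : ℝ)) := by
        rw [← Real.rpow_add hr0]
        congr 1
        ring
      rw [e1, e2]
      nlinarith
    have hpow : r ^ ((u.length : ℝ) - 1) = r ^ u.length / r := by
      rw [Real.rpow_sub hr0, Real.rpow_natCast, Real.rpow_one]
    rw [SimpleGraph.Walk.length_cons]
    push_cast
    calc dist (F.wordMap u x₀) (F.wordMap v x₀)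
        ≤ 2 * M * r ^ u.length / r + 2 * M / (1 - r) *
          (r ^ ((u.length : ℝ) - (p.length + 1)) - r ^ ((u.length : ℝ) - 1)) := by
          refine htri.trans (add_le_add hstep (ih.trans ?_))
          gcongr
      _ = _ := by
          rw [hpow, Real.rpow_natCast]
          field_simp
          ring

theorem scaledDist_le_rpow_gromovProduct (hr0 : 0 < r) (hr1 : r < 1) {M : ℝ}
    (hJi : ∀ i, F.map i '' J ⊆ J) (hM : ∀ x ∈ J, ∀ y ∈ J, dist x y ≤ M)
    {x₀ : EuclideanSpace ℝ (Fin d)} (hx₀ : x₀ ∈ J) (u v : List (Fin m)) :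
    RootedGraph.scaledDist (fun w => F.wordMap w x₀) List.length r u v ≤
      (4 * M / (1 - r) / r + 2) *
        r ^ RootedGraph.gromovProduct (F.augmentedTree J) [] u v := by
  have hM0 : 0 ≤ M := dist_nonneg.trans (hM x₀ hx₀ x₀ hx₀)
  have hr1' : 0 < 1 - r := sub_pos.2 hr1
  obtain ⟨p, hp⟩ := (augmentedTree_connected F J).exists_walk_length_eq_dist u v
  have huv := length_le_add_walk_length p
  have hvu := length_le_add_walk_length p.reverse
  rw [SimpleGraph.Walk.length_reverse] at hvu
  rw [gromovProduct_eq, ← hp]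
  set g : ℝ := ((u.length : ℝ) + v.length - p.length) / 2 with hg
  -- The geodesic is cut at j, which is |u| - g rounded down, so that a climb of j from u or of the
  -- remaining length from v ends no higher than level g - 1.
  obtain ⟨j, hj⟩ : ∃ j, j = (u.length + p.length - v.length) / 2 := ⟨_, rfl⟩
  have hjk : j ≤ p.length := by lia
  have h2j : 2 * j + v.length ≤ u.length + p.length := by lia
  have h2j' : u.length + p.length ≤ 2 * j + v.length + 1 := by lia
  have h1 := dist_wordMap_le_of_walk hr0 hr1 hJi hM hx₀ (p.take j)
  have h2 := dist_wordMap_le_of_walk hr0 hr1 hJi hM hx₀ (p.drop j).reverse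
  rw [SimpleGraph.Walk.take_length, min_eq_left hjk] at h1
  rw [SimpleGraph.Walk.length_reverse, SimpleGraph.Walk.drop_length, Nat.cast_sub hjk] at h2
  rify at h2j h2j' huv hvu
  have hg1 : r ^ ((u.length : ℝ) - j) ≤ r ^ (g - 1) :=
    Real.rpow_le_rpow_of_exponent_ge hr0 hr1.le (by linarith)
  have hg2 : r ^ ((v.length : ℝ) - (p.length - j)) ≤ r ^ (g - 1) :=
    Real.rpow_le_rpow_of_exponent_ge hr0 hr1.le (by linarith)
  have hgu : r ^ u.length ≤ r ^ g := by
    rw [← Real.rpow_natCast]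
    exact Real.rpow_le_rpow_of_exponent_ge hr0 hr1.le (by linarith)
  have hgv : r ^ v.length ≤ r ^ g := by
    rw [← Real.rpow_natCast]
    exact Real.rpow_le_rpow_of_exponent_ge hr0 hr1.le (by linarith)
  have hD : 0 ≤ 2 * M / (1 - r) := by positivity
  have h1' := h1.trans (mul_le_mul_of_nonneg_left
    ((sub_le_self _ (Real.rpow_nonneg hr0.le _)).trans hg1) hD)
  have h2' := h2.trans (mul_le_mul_of_nonneg_left
    ((sub_le_self _ (Real.rpow_nonneg hr0.le _)).trans hg2) hD)
  have htri := dist_triangle_right (F.wordMap u x₀) (F.wordMap v x₀)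
    (F.wordMap (p.getVert j) x₀)
  have hpow : r ^ (g - 1) = r ^ g / r := by rw [Real.rpow_sub hr0, Real.rpow_one]
  rw [hpow] at h1' h2'
  unfold RootedGraph.scaledDist
  calc _ ≤ 2 * M / (1 - r) * (r ^ g / r) + 2 * M / (1 - r) * (r ^ g / r) + r ^ g + r ^ g := by
        linarith
    _ = _ := by ring

theorem exists_rpow_gromovProduct_le (hr0 : 0 < r) (hr1 : r < 1) (hK : F.IsSelfSimilarSet K)
    (hH : F.ConditionH K) (hKJ : K ⊆ J) {x₀ : EuclideanSpace ℝ (Fin d)} (hx₀ : x₀ ∈ K) :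
    ∃ C : ℝ, ∀ u v : List (Fin m),
      r ^ RootedGraph.gromovProduct (F.augmentedTree J) [] u v ≤
        C * RootedGraph.scaledDist (fun w => F.wordMap w x₀) List.length r u v := by
  classical
  obtain ⟨c, hc, hH⟩ := hH
  refine ⟨r⁻¹ + r⁻¹ * (r⁻¹ * c⁻¹), fun u v => ?_⟩
  have hq := RootedGraph.scaledDist_pos (π := fun w => F.wordMap w x₀) (ℓ := List.length) hr0 u v
  set q := RootedGraph.scaledDist (fun w => F.wordMap w x₀) List.length r u v with hqdef
  have hqu : r ^ u.length ≤ q := by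
    rw [hqdef, RootedGraph.scaledDist]
    have := pow_pos hr0 v.length
    have := dist_nonneg (x := F.wordMap u x₀) (y := F.wordMap v x₀)
    linarith
  have hqv : r ^ v.length ≤ q := by
    rw [hqdef, RootedGraph.scaledDist]
    have := pow_pos hr0 u.length
    have := dist_nonneg (x := F.wordMap u x₀) (y := F.wordMap v x₀)
    linarith
  have hqd : dist (F.wordMap u x₀) (F.wordMap v x₀) ≤ q := by
    rw [hqdef, RootedGraph.scaledDist]
    have := pow_pos hr0 u.length
    have := pow_pos hr0 v.length
    linarith
  -- `P n` says that the prefixes of length n are equal or adjacent. Its last n satisfies n - 1/2 ≤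
  -- |u ∧ v|, which gives the outer factor r⁻¹.
  let P : ℕ → Prop := fun n => (F.augmentedTree J).dist (u.take n) (v.take n) ≤ 1
  obtain ⟨n, hn⟩ : ∃ n, n = Nat.findGreatest P (min u.length v.length) := ⟨_, rfl⟩
  have hnle : n ≤ min u.length v.length := hn ▸ Nat.findGreatest_le _
  have hPn : P n := by
    rw [hn]
    exact Nat.findGreatest_spec (P := P) (Nat.zero_le _) (by simp [P])
  have hnu := hnle.trans (min_le_left _ _)
  have hnv := hnle.trans (min_le_right _ _)
  have hdist := dist_le_of_take hnu hnv hPn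
  have hg : r ^ RootedGraph.gromovProduct (F.augmentedTree J) [] u v ≤ r⁻¹ * r ^ n := by
    have : r⁻¹ * r ^ n = r ^ ((n : ℝ) - 1) := by
      rw [Real.rpow_sub hr0, Real.rpow_natCast, Real.rpow_one]
      ring
    rw [this, gromovProduct_eq]
    rify at hdist
    exact Real.rpow_le_rpow_of_exponent_ge hr0 hr1.le (by linarith)
  -- Either n exhausts the shorter word, and r^n is a term of q, or (H) applies at level n + 1,
  -- whence the further factor r⁻¹ c⁻¹.
  have hnq : r ^ n ≤ q + r⁻¹ * c⁻¹ * q := by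
    rcases hnle.eq_or_lt with heq | hlt
    · have h1 : r ^ n ≤ q := by
        rcases min_choice u.length v.length with h | h <;> rw [heq, h] <;> assumption
      have h2 : 0 ≤ r⁻¹ * c⁻¹ * q := by positivity
      linarith
    · have hnot : ¬ P (n + 1) :=
        Nat.findGreatest_is_greatest (hn ▸ Nat.lt_succ_self n) hlt
      have hlu : (u.take (n + 1)).length = n + 1 := by rw [List.length_take]; lia
      have hlv : (v.take (n + 1)).length = n + 1 := by rw [List.length_take]; lia
      have hmem : ∀ w : List (Fin m), F.wordMap w x₀ ∈ F.wordMap (w.take (n + 1)) '' K := by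
        intro w
        refine ⟨F.wordMap (w.drop (n + 1)) x₀, wordMap_mem F hK.map_subset _ hx₀, ?_⟩
        rw [← wordMap_append, List.take_append_drop]
      have hdisj : Disjoint (F.wordMap (u.take (n + 1)) '' K)
          (F.wordMap (v.take (n + 1)) '' K) := by
        rw [Set.disjoint_iff_inter_eq_empty, ← Set.not_nonempty_iff_eq_empty]
        intro hne
        refine hnot ?_
        -- Meeting cells of K force meeting cells of J, as K ⊆ J, so the prefixes would be equal or
        -- adjacent one level later.
        by_cases huv : u.take (n + 1) = v.take (n + 1)
        · simp [P, huv]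
        · refine (SimpleGraph.dist_eq_one_iff_adj.2 (Or.inr ⟨hlu.trans hlv.symm, huv, ?_⟩)).le
          exact hne.mono (Set.inter_subset_inter (Set.image_mono hKJ) (Set.image_mono hKJ))
      have h1 := (hH (n + 1) (by lia) _ _ hlu hlv hdisj _ (hmem u) _ (hmem v)).trans hqd
      have h2 : r ^ n = r⁻¹ * c⁻¹ * (c * r ^ (n + 1)) := by
        rw [pow_succ]
        field_simp
      have h3 : r ^ n ≤ r⁻¹ * c⁻¹ * q := by
        rw [h2]
        gcongr
      linarith
  calc _ ≤ r⁻¹ * r ^ n := hg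
    _ ≤ r⁻¹ * (q + r⁻¹ * c⁻¹ * q) := by gcongr
    _ = _ := by ring

/-- Under condition (H), the augmented tree codes the self-similar set. -/
theorem exists_isCoding (hr0 : 0 < r) (hr1 : r < 1) (hK : F.IsSelfSimilarSet K)
    (hH : F.ConditionH K) (hJ : F.IsBoundedClosedInvariant J) :
    ∃ (C : ℝ) (π : List (Fin m) → EuclideanSpace ℝ (Fin d)),
      RootedGraph.IsCoding (F.augmentedTree J) [] K r C π List.length := by
  have hKJ := hK.subset_of_isBoundedClosedInvariant hr0 hr1 hJ
  obtain ⟨x₀, hx₀⟩ := hK.1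
  obtain ⟨M, hM⟩ := Metric.isBounded_iff.1 hJ.2.1
  obtain ⟨C, hC⟩ := exists_rpow_gromovProduct_le hr0 hr1 hK hH hKJ hx₀
  have hC' := scaledDist_le_rpow_gromovProduct hr0 hr1 hJ.2.2.2
    (fun x hx y hy => hM hx hy) (hKJ hx₀)
  refine ⟨max 1 (max C (4 * M / (1 - r) / r + 2)), fun w => F.wordMap w x₀, le_max_left _ _,
    fun u => wordMap_mem F hK.map_subset u hx₀, fun u v => (hC' u v).trans ?_,
    fun u v => (hC u v).trans ?_, fun x hx => ?_⟩
  · gcongr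
    exact (le_max_right _ _).trans (le_max_right _ _)
  · have := RootedGraph.scaledDist_pos (π := fun w => F.wordMap w x₀) (ℓ := List.length) hr0 u v
    gcongr
    exact (le_max_left _ _).trans (le_max_right _ _)
  · choose u hu y hy hxy using fun n => hK.exists_word n hx
    refine ⟨u, ?_, by simp only [hu]; exact tendsto_id⟩
    rw [tendsto_iff_dist_tendsto_zero]
    have h0 : Tendsto (fun n => r ^ n * M) atTop (𝓝 0) := by
      simpa using (tendsto_pow_atTop_nhds_zero_of_lt_one hr0.le hr1).mul_const M
    refine squeeze_zero (fun n => dist_nonneg) (fun n => ?_) h0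
    rw [← hxy n, dist_wordMap F hr0.le, hu n]
    gcongr
    exact hM (hKJ hx₀) (hKJ (hy n))

end SimilitudeIFS

/-! ### The proposition -/

theorem proposition3p10 {d d' m : ℕ} {r : ℝ} (hr0 : 0 < r) (hr1 : r < 1)
    (F : SimilitudeIFS d m r) (F' : SimilitudeIFS d' m r)
    (K : Set (EuclideanSpace ℝ (Fin d))) (K' : Set (EuclideanSpace ℝ (Fin d')))
    (hK : F.IsSelfSimilarSet K) (hK' : F'.IsSelfSimilarSet K')
    (hH : F.ConditionH K) (hH' : F'.ConditionH K')
    (J : Set (EuclideanSpace ℝ (Fin d))) (J' : Set (EuclideanSpace ℝ (Fin d')))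
    (hJ : F.IsBoundedClosedInvariant J) (hJ' : F'.IsBoundedClosedInvariant J')
    (h : (F.OSC ∧ F'.OSC) ∨ (F.IsSimple J ∧ F'.IsSimple J')) :
    RootedGraph.IsHyperbolic (F.augmentedTree J) [] ∧
    RootedGraph.IsHyperbolic (F'.augmentedTree J') [] ∧
    ∀ a : ℝ, RootedGraph.IsAdmissible (F.augmentedTree J) [] a →
      RootedGraph.IsAdmissible (F'.augmentedTree J') [] a →
      (LipschitzEquivalent (fun x y : K => dist x y) (fun x y : K' => dist x y) ↔
        LipschitzEquivalent (RootedGraph.boundaryRho (F.augmentedTree J) [] a)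
          (RootedGraph.boundaryRho (F'.augmentedTree J') [] a)) := by
  obtain ⟨C, π, hc⟩ := SimilitudeIFS.exists_isCoding hr0 hr1 hK hH hJ
  obtain ⟨C', π', hc'⟩ := SimilitudeIFS.exists_isCoding hr0 hr1 hK' hH' hJ'
  refine ⟨hc.isHyperbolic hr0 hr1, hc'.isHyperbolic hr0 hr1, fun a ha ha' => ?_⟩
  have hα : 0 < a / -Real.log r := div_pos ha.1 (neg_pos.2 (Real.log_neg hr0 hr1))
  have hX := hc.lipschitzEquivalent_boundary hr0 hr1 ha hK.2.1.isClosed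
  have hY := hc'.lipschitzEquivalent_boundary hr0 hr1 ha' hK'.2.1.isClosed
  -- Both boundaries are snowflakes with the same exponent α, so K and K' may be compared through
  -- dist^α.
  rw [← LipschitzEquivalent.rpow_iff (fun _ _ => dist_nonneg) (fun _ _ => dist_nonneg) hα]
  exact ⟨fun h => (hX.trans h).trans hY.symm, fun h => (hX.symm.trans h).trans hY⟩
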